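/- A partition is a finite weakly decreasing sequence $\lambda=(\lambda_1\ge\dots\ge\lambda_\ell)$ of positive integers (possibly empty); write $\ell(\lambda)=\ell$, $|\lambda|=\lambda_1+\dots+\lambda_\ell$, and let $m_i(\lambda)$ be the number of parts equal to $i$. A finite sequence matches a nonempty finite sequence $v$ if $v$ occurs in it as a block of consecutive entries. Let $\mathcal{N}$ be the set of partitions $\lambda$ such that (N1) $\lambda_i-\lambda_{i+1}\ne 1$ for $1\le i\le\ell(\lambda)-1$; and, for $1\le i\le\ell(\lambda)-2$, (N2) $\lambda_i-\lambda_{i+2}\ge 3$; (N3) $\lambda_i-\lambda_{i+2}=3$ implies $\lambda_i\ne\lambda_{i+1}$; (N4) $\lambda_i-\lambda_{i+2}=3$ and $2\nmid\lambda_i$ imply $\lambda_{i+1}\ne\lambda_{i+2}$; (N5) $\lambda_i-\lambda_{i+2}=4$ and $2\nmid\lambda_i$ imply $\lambda_i\ne\lambda_{i+1}$ and $\lambda_{i+1}\ne\lambda_{i+2}$; (N6) the sequence $(\lambda_1-\lambda_2,\lambda_2-\lambda_3,\dots,\lambda_{\ell(\lambda)-1}-\lambda_{\ell(\lambda)})$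 does not match $(3,\underbrace{2,\dots,2}_{k},3,0)$ for any $k\ge0$. Put $$\mathcal{N}_1=\{\lambda\in\mathcal{N}\mid m_1(\lambda)=0\},\qquad \mathcal{N}_2=\{\lambda\in\mathcal{N}\mid m_i(\lambda)\le1\text{ for }i=1,2,3\},$$ and let $\mathcal{N}_3$ be the set of $\lambda\in\mathcal{N}$ with $m_1(\lambda)=m_3(\lambda)=0$, $m_2(\lambda)\le1$ that do not match $(2k+3,2k,2k-2,\dots,4,2)$ for any $k\ge1$. For a set $\mathcal{C}$ of partitions let $f_{\mathcal{C}}(x,q)=\sum_{\lambda\in\mathcal{C}}x^{\ell(\lambda)}q^{|\lambda|}$, a formal power series in $x$ and $q$. Then, for $a=1,2,3$, $$0=\sum_{i=0}^{5}p^{(a)}_{2i}(x,q)\,f_{\mathcal{N}_a}(xq^{2i},q),$$ where $p^{(a)}_0=1$ for $a=1,2,3$, and for $a=1$: $$\begin{aligned} p^{(1)}_2&=-1-x(q^2+q^3+q^4), & p^{(1)}_4&=xq^4(1-x+xq^3+xq^4+xq^5),\\ p^{(1)}_6&=x^2q^6\bigl(-1+xq^4(1+q+q^2-q^5)\bigr),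 & p^{(1)}_8&=x^3q^{13}(1+q+q^2)(1-xq^6),\\ p^{(1)}_{10}&=x^3q^{17}(1-xq^6)(1-xq^8); \end{aligned}$$ for $a=2$: $$\begin{aligned} p^{(2)}_2&=-1-x(q+q^2+q^4), & p^{(2)}_4&=xq^4(1+xq+xq^3),\\ p^{(2)}_6&=x^2q^{10}(-1+xq^4+xq^6), & p^{(2)}_8&=x^3q^{15}(1+q^2+q^3)(1-xq^6),\\ p^{(2)}_{10}&=x^3q^{19}(1-xq^6)(1-xq^8); \end{aligned}$$ for $a=3$: $$\begin{aligned} p^{(3)}_2&=-1-x(q^2+q^4+q^5), & p^{(3)}_4&=xq^4(1+xq^5+xq^7),\\ p^{(3)}_6&=x^2q^{10}(-1+xq^4+xq^6), & p^{(3)}_8&=x^3q^{18}(1+q+q^3)(1-xq^6),\\ p^{(3)}_{10}&=x^3q^{23}(1-xq^6)(1-xq^8). \end{aligned}$$ -/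

import Mathlib

namespace Nandi

/-- The set of all partitions: weakly decreasing finite sequences of positive integers.
The part `λ_i` (`i ≥ 1`) of a partition `l` is `l[i - 1]`, `ℓ(λ)` is `l.length`, `|λ|` is `l.sum`,
and `m_i(λ)` is `l.count i`. -/
def Par : Set (List ℕ) := {l | l.Pairwise (· ≥ ·) ∧ ∀ i ∈ l, 0 < i}

/-- The sequence of differences `(λ₁ - λ₂, λ₂ - λ₃, …)`. On partitions, which are weakly decreasing,
the truncated subtraction of natural numbers is the usual one (here and below). -/
def diffs (l : List ℕ) : List ℕ := List.zipWith (· - ·) l l.tail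

/-- The set `𝒩`; `v <:+: w` says that the sequence `w` matches `v`, that is, `v` occurs in `w`
as a block of consecutive entries. -/
structure IsNandi (l : List ℕ) : Prop where
  mem_par : l ∈ Par
  cond1 : ∀ i (_ : i + 1 < l.length), l[i] - l[i + 1] ≠ 1
  cond2 : ∀ i (_ : i + 2 < l.length), 3 ≤ l[i] - l[i + 2]
  cond3 : ∀ i (_ : i + 2 < l.length), l[i] - l[i + 2] = 3 → l[i] ≠ l[i + 1]
  cond4 : ∀ i (_ : i + 2 < l.length), l[i] - l[i + 2] = 3 → ¬ 2 ∣ l[i] → l[i + 1] ≠ l[i + 2]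
  cond5 : ∀ i (_ : i + 2 < l.length), l[i] - l[i + 2] = 4 → ¬ 2 ∣ l[i] →
    l[i] ≠ l[i + 1] ∧ l[i + 1] ≠ l[i + 2]
  cond6 : ∀ k : ℕ, ¬ ([3] ++ List.replicate k 2 ++ [3, 0]) <:+: diffs l

/-- `𝒩₁` -/
def N₁ : Set (List ℕ) := {l | IsNandi l ∧ l.count 1 = 0}

/-- `𝒩₂` -/
def N₂ : Set (List ℕ) := {l | IsNandi l ∧ l.count 1 ≤ 1 ∧ l.count 2 ≤ 1 ∧ l.count 3 ≤ 1}

/-- The sequence `(2k+3, 2k, 2k-2, …, 4, 2)`. -/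
def staircase (k : ℕ) : List ℕ := (2 * k + 3) :: (List.range k).map (fun j => 2 * (k - j))

/-- `𝒩₃` -/
def N₃ : Set (List ℕ) :=
  {l | IsNandi l ∧ l.count 1 = 0 ∧ l.count 3 = 0 ∧ l.count 2 ≤ 1 ∧
    ∀ k : ℕ, 1 ≤ k → ¬ staircase k <:+: l}

/-- The elements of `C` with `m` parts and with sum `n`. -/
def level (C : Set (List ℕ)) (m n : ℕ) : Set (List ℕ) := {l ∈ C | l.length = m ∧ l.sum = n}

theorem level_finite (C : Set (List ℕ)) (m n : ℕ) : (level C m n).Finite := by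
  refine (List.finite_length_eq (Fin (n + 1)) m |>.image (List.map Fin.val)).subset ?_
  rintro l ⟨-, hm, hn⟩
  have h : ∀ a ∈ l, a < n + 1 := fun a ha => by
    have := List.le_sum_of_mem ha
    omega
  refine ⟨l.pmap (fun a ha => (⟨a, ha⟩ : Fin (n + 1))) h, by simpa using hm, ?_⟩
  simp [List.map_pmap]

open PowerSeries in
/-- The generating function `f_C(x, q) = ∑_{λ ∈ C} x^{ℓ(λ)} q^{|λ|}` in `ℤ⟦q⟧⟦x⟧`: the coefficient
of `x^m q^n` is the number of `λ ∈ C` with `ℓ(λ) = m` and `|λ| = n` (a finite number). -/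
noncomputable def genFun (C : Set (List ℕ)) : ℤ⟦X⟧⟦X⟧ :=
  PowerSeries.mk fun m => PowerSeries.mk fun n => ((level C m n).ncard : ℤ)

open PowerSeries in
/-- The variable `x` of `ℤ⟦q⟧⟦x⟧`. -/
noncomputable def x : ℤ⟦X⟧⟦X⟧ := PowerSeries.X

open PowerSeries in
/-- The variable `q` of `ℤ⟦q⟧⟦x⟧`. -/
noncomputable def q : ℤ⟦X⟧⟦X⟧ := PowerSeries.C PowerSeries.X

open PowerSeries in
/-- The series `f(x q^k, q)` for `f = f(x, q)`. -/
noncomputable def qShift (k : ℕ) (f : ℤ⟦X⟧⟦X⟧) : ℤ⟦X⟧⟦X⟧ :=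
  PowerSeries.rescale (PowerSeries.X ^ k) f

/-- The polynomials `p_{2i}(x, q)`, `i = 0, …, 5`, for `𝒩₁`. -/
def p₁ {R : Type*} [CommRing R] (x q : R) : Fin 6 → R :=
  ![1,
    -1 - x * (q ^ 2 + q ^ 3 + q ^ 4),
    x * q ^ 4 * (1 - x + x * q ^ 3 + x * q ^ 4 + x * q ^ 5),
    x ^ 2 * q ^ 6 * (-1 + x * q ^ 4 * (1 + q + q ^ 2 - q ^ 5)),
    x ^ 3 * q ^ 13 * (1 + q + q ^ 2) * (1 - x * q ^ 6),
    x ^ 3 * q ^ 17 * (1 - x * q ^ 6) * (1 - x * q ^ 8)]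

/-- The polynomials `p_{2i}(x, q)`, `i = 0, …, 5`, for `𝒩₂`. -/
def p₂ {R : Type*} [CommRing R] (x q : R) : Fin 6 → R :=
  ![1,
    -1 - x * (q + q ^ 2 + q ^ 4),
    x * q ^ 4 * (1 + x * q + x * q ^ 3),
    x ^ 2 * q ^ 10 * (-1 + x * q ^ 4 + x * q ^ 6),
    x ^ 3 * q ^ 15 * (1 + q ^ 2 + q ^ 3) * (1 - x * q ^ 6),
    x ^ 3 * q ^ 19 * (1 - x * q ^ 6) * (1 - x * q ^ 8)]

/-- The polynomials `p_{2i}(x, q)`, `i = 0, …, 5`, for `𝒩₃`. -/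
def p₃ {R : Type*} [CommRing R] (x q : R) : Fin 6 → R :=
  ![1,
    -1 - x * (q ^ 2 + q ^ 4 + q ^ 5),
    x * q ^ 4 * (1 + x * q ^ 5 + x * q ^ 7),
    x ^ 2 * q ^ 10 * (-1 + x * q ^ 4 + x * q ^ 6),
    x ^ 3 * q ^ 18 * (1 + q + q ^ 3) * (1 - x * q ^ 6),
    x ^ 3 * q ^ 23 * (1 - x * q ^ 6) * (1 - x * q ^ 8)]

end Nandi

/-! The set `𝒩` is recognised by a finite-state device that reads a partition from its smallest part
on, remembering only the largest part so far and how it was reached; the forbidden blocks of (N6)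
and the staircases excluded from `𝒩₃` are both tracked by a flag that survives differences `2` and
rejects a difference `3`. The three sets `𝒩₁`, `𝒩₂`, `𝒩₃` then differ only in the starting state and
in the least part allowed. Since the rules depend on parts only through differences and parities,
lowering all parts by `2` is harmless, and it turns `f(x, q)` into `f(x q ^ 2, q)`. Peeling off the
parts `1` and `2` therefore gives a linear `q`-difference system for the series of `𝒩`, `𝒩₁`, `𝒩₂`,
`𝒩₃` and `𝒩₁ ∩ 𝒩₂`, and elimination leaves one equation for each of `𝒩₁`, `𝒩₂`, `𝒩₃`. -/

namespace Nandi

/-! ### The automaton -/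

/-- What a reader of a partition, from the smallest part on, has to remember about the largest part
read so far: it has occurred twice (`double`), it ends a block `0, 3, 2, …, 2` of differences, read
in that order (`flagged`), or, failing both, it may (`free`) or may not (`plain`) be repeated. -/
inductive Kind
  | double | flagged | free | plain

/-- A state of the automaton that reads a partition from its smallest part on: the largest part
read so far, and its kind. -/
structure State where
  last : ℤ
  kind : Kind

/-- The kind of a part `a` that exceeds its predecessor by `d` and does not prolong a block
`0, 3, 2, …, 2`. -/
def Kind.ofGap (d : ℤ) (a : ℕ) : Kind := if 5 ≤ d ∨ d = 4 ∧ 2 ∣ a then .free else .plain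

/-- The kind of a part `a` that exceeds by `d` a predecessor of the given kind; it is `none` if `a`
may not follow. -/
def Kind.next (d : ℤ) (a : ℕ) : Kind → Option Kind
  | .double =>
    if d = 3 ∧ 2 ∣ a then some .flagged else if 5 ≤ d ∨ d = 4 ∧ 2 ∣ a then some .free else none
  | .flagged =>
    if d = 2 then some .flagged else if 4 ≤ d then some (ofGap d a) else none
  | .free => if d = 0 then some .double else if 2 ≤ d then some (ofGap d a) else none
  | .plain => if 2 ≤ d then some (ofGap d a) else none

/-- The transition function of the automaton; `none` is rejection. -/
def step (s : State) (a : ℕ) : Option State := (s.kind.next (a - s.last) a).map (State.mk a)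

/-- The state reached on reading a list from its end. -/
def run (s : Option State) (l : List ℕ) : Option State := l.foldr (fun a o => o.bind (step · a)) s

/-- The lists of integers greater than `k` that the automaton accepts from a given state. -/
def accepted (k : ℕ) (s : Option State) : Set (List ℕ) := {l | (∀ i ∈ l, k < i) ∧ (run s l).isSome}

/-- The initial state: every positive part exceeds `-4` by at least `5`, and so becomes `free`. -/
def State.init : State := ⟨-4, .free⟩

/-- The state with the largest part lowered by two. -/
def State.shift (s : State) : State := ⟨s.last - 2, s.kind⟩

theorem run_append (s : Option State) (l b : List ℕ) : run s (l ++ b) = run (run s b) l :=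
  List.foldr_append

theorem run_cons (s : Option State) (a : ℕ) (l : List ℕ) :
    run s (a :: l) = (run s l).bind (step · a) := rfl

theorem run_none (l : List ℕ) : run none l = none := by
  induction l with
  | nil => rfl
  | cons a l ih => simp [run_cons, ih]

theorem nil_mem_accepted (k : ℕ) (s : State) : [] ∈ accepted k (some s) := by simp [accepted, run]

theorem concat_mem_accepted {k : ℕ} {s : State} {l : List ℕ} {a : ℕ} :
    l ++ [a] ∈ accepted k (some s) ↔ k < a ∧ l ∈ accepted k (step s a) := by
  simp only [accepted, Set.mem_ofPred_eq, run_append, List.forall_mem_append,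
    List.forall_mem_singleton]
  exact ⟨fun ⟨⟨h, ha⟩, h'⟩ => ⟨ha, h, h'⟩, fun ⟨ha, h, h'⟩ => ⟨⟨h, ha⟩, h'⟩⟩

theorem accepted_none (k : ℕ) : accepted k none = ∅ := by simp [accepted, run_none]

theorem accepted_congr {k : ℕ} {s t : State} (h : ∀ a, k < a → step s a = step t a) :
    accepted k (some s) = accepted k (some t) := by
  ext l
  cases l using List.reverseRecOn with
  | nil => simp only [nil_mem_accepted]
  | append_singleton l a =>
    rw [concat_mem_accepted, concat_mem_accepted]
    exact and_congr_right fun ha => by rw [h a ha]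

theorem mem_accepted_succ {k : ℕ} {s : Option State} {l : List ℕ} :
    l ∈ accepted (k + 1) s ↔ l ∈ accepted k s ∧ k + 1 ∉ l := by
  simp only [accepted, Set.mem_ofPred_eq]
  grind

theorem step_eq_some {s t : State} {a : ℕ} (h : step s a = some t) : t.last = a ∧ s.last ≤ a := by
  obtain ⟨p, K⟩ := s
  cases K <;> grind [step, Kind.next]

theorem le_of_mem_accepted {k : ℕ} {s : State} {l : List ℕ} (h : l ∈ accepted k (some s)) :
    ∀ i ∈ l, s.last ≤ i := by
  induction l using List.reverseRecOn generalizing s with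
  | nil => simp
  | append_singleton l a ih =>
    obtain ⟨-, h⟩ := concat_mem_accepted.1 h
    cases ht : step s a with
    | none => simp [ht, accepted_none] at h
    | some t =>
      obtain ⟨hta, hsa⟩ := step_eq_some ht
      rw [ht] at h
      simp only [List.forall_mem_append, List.forall_mem_singleton]
      exact ⟨fun i hi => hsa.trans (hta ▸ ih h i hi), hsa⟩

theorem map_shift_step_add_two (s : State) (a : ℕ) :
    (step s (a + 2)).map State.shift = step s.shift a := by
  obtain ⟨p, K⟩ := s
  have h : (a + 2 : ℕ) - p = a - (p - 2) := by push_cast; ring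
  have h2 : 2 ∣ a + 2 ↔ 2 ∣ a := Nat.dvd_add_self_right
  have hnext : K.next (a - (p - 2)) (a + 2) = K.next (a - (p - 2)) a := by
    cases K <;> simp only [Kind.next, Kind.ofGap, h2]
  simp only [step, State.shift, h, hnext, Option.map_map]
  congr 1
  ext K : 1
  simp [State.shift]

theorem map_shift_run_map_add_two (s : Option State) (l : List ℕ) :
    (run s (l.map (· + 2))).map State.shift = run (s.map State.shift) l := by
  induction l with
  | nil => rfl
  | cons a l ih =>
    rw [List.map_cons, run_cons, run_cons, ← ih]
    cases run s (l.map (· + 2)) with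
    | none => rfl
    | some t => exact map_shift_step_add_two t a

theorem accepted_add_two (k : ℕ) (s : Option State) :
    accepted (k + 2) s = List.map (· + 2) '' accepted k (s.map State.shift) := by
  have hmem (l : List ℕ) :
      l.map (· + 2) ∈ accepted (k + 2) s ↔ l ∈ accepted k (s.map State.shift) := by
    rw [accepted, accepted, Set.mem_ofPred_eq, Set.mem_ofPred_eq, ← map_shift_run_map_add_two,
      Option.isSome_map]
    simp
  ext l
  refine ⟨fun hl => ?_, ?_⟩
  · have hrange : l ∈ Set.range (List.map (· + 2)) := by
      rw [Set.range_list_map]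
      exact fun i hi => ⟨i - 2, by have := hl.1 i hi; dsimp; omega⟩
    obtain ⟨l', rfl⟩ := hrange
    exact ⟨l', (hmem l').1 hl, rfl⟩
  · rintro ⟨l', hl', rfl⟩
    exact (hmem l').2 hl'

theorem le_of_concat_mem_accepted {k : ℕ} {s : State} {l : List ℕ} {a : ℕ}
    (h : l ++ [a] ∈ accepted k (some s)) : ∀ i ∈ l, a ≤ i := by
  obtain ⟨-, h⟩ := concat_mem_accepted.1 h
  cases ht : step s a with
  | none => simp [ht, accepted_none] at h
  | some t =>
    rw [ht] at h
    have hta := (step_eq_some ht).1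
    exact fun i hi => by have := le_of_mem_accepted h i hi; omega

theorem accepted_eq_union (k : ℕ) (s : State) :
    accepted k (some s) =
      accepted (k + 1) (some s) ∪ (· ++ [k + 1]) '' accepted k (step s (k + 1)) := by
  ext l
  refine ⟨fun hl => ?_, ?_⟩
  · by_cases hk : k + 1 ∈ l
    · cases l using List.reverseRecOn with
      | nil => simp at hk
      | append_singleton l a =>
        have hka : k + 1 = a := by
          have hle := le_of_concat_mem_accepted hl
          have hlt := hl.1 a (by simp)
          grind
        subst hka
        exact Or.inr ⟨l, (concat_mem_accepted.1 hl).2, rfl⟩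
    · exact Or.inl (mem_accepted_succ.2 ⟨hl, hk⟩)
  · rintro (hl | ⟨l, hl, rfl⟩)
    · exact (mem_accepted_succ.1 hl).1
    · exact concat_mem_accepted.2 ⟨k.lt_succ_self, hl⟩

theorem disjoint_accepted_succ (k : ℕ) (s t : Option State) :
    Disjoint (accepted (k + 1) s) ((· ++ [k + 1]) '' accepted k t) := by
  rw [Set.disjoint_left]
  rintro _ hl ⟨l, -, rfl⟩
  exact (mem_accepted_succ.1 hl).2 (by simp)

/-! ### The sets `𝒩₁`, `𝒩₂` and `𝒩₃` as accepted languages -/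

theorem diffs_cons_cons (a b : ℕ) (r : List ℕ) : diffs (a :: b :: r) = (a - b) :: diffs (b :: r) :=
  rfl

theorem diffs_suffix_diffs_cons (a : ℕ) (l : List ℕ) : diffs l <:+ diffs (a :: l) := by
  cases l with
  | nil => exact List.nil_suffix
  | cons b r => exact List.suffix_cons (a - b) _

theorem cons_mem_par {a : ℕ} {l : List ℕ} :
    a :: l ∈ Par ↔ l ∈ Par ∧ 0 < a ∧ ∀ b ∈ l, b ≤ a := by
  simp only [Par, Set.mem_ofPred_eq, List.pairwise_cons, List.forall_mem_cons]
  tauto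

theorem IsNandi.tail {a : ℕ} {l : List ℕ} (h : IsNandi (a :: l)) : IsNandi l where
  mem_par := (cons_mem_par.1 h.mem_par).1
  cond1 i hi := h.cond1 (i + 1) (Nat.succ_lt_succ hi)
  cond2 i hi := h.cond2 (i + 1) (Nat.succ_lt_succ hi)
  cond3 i hi := h.cond3 (i + 1) (Nat.succ_lt_succ hi)
  cond4 i hi := h.cond4 (i + 1) (Nat.succ_lt_succ hi)
  cond5 i hi := h.cond5 (i + 1) (Nat.succ_lt_succ hi)
  cond6 k hk := h.cond6 k (hk.trans (diffs_suffix_diffs_cons a l).isInfix)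

/-- The differences begin with a block `2, …, 2, 3, 0`, so that a further difference `3` in front of
them is forbidden by (N6). -/
def StartsFlagged (l : List ℕ) : Prop := ∃ k : ℕ, (List.replicate k 2 ++ [3, 0]) <+: diffs l

theorem not_startsFlagged_pair (a b : ℕ) : ¬ StartsFlagged [a, b] := by
  rintro ⟨k, hk⟩
  have hlen := hk.length_le
  simp [diffs] at hlen

theorem startsFlagged_cons {a b c : ℕ} {r : List ℕ} : StartsFlagged (a :: b :: c :: r) ↔
    (a - b = 2 ∧ StartsFlagged (b :: c :: r)) ∨ (a - b = 3 ∧ b - c = 0) := by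
  simp only [StartsFlagged, diffs_cons_cons]
  refine ⟨?_, ?_⟩
  · rintro ⟨_ | k, hk⟩ <;>
      simp only [List.replicate_zero, List.replicate_succ, List.nil_append, List.cons_append,
        List.cons_prefix_cons] at hk
    · exact Or.inr ⟨hk.1.symm, hk.2.1.symm⟩
    · exact Or.inl ⟨hk.1.symm, k, hk.2⟩
  · rintro (⟨hab, k, hk⟩ | ⟨hab, hbc⟩)
    · exact ⟨k + 1, List.cons_prefix_cons.2 ⟨hab.symm, hk⟩⟩
    · exact ⟨0, by simp [hab, hbc]⟩

theorem isNandi_nil : IsNandi [] := by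
  constructor <;> simp [Par, diffs]

theorem isNandi_singleton {a : ℕ} : IsNandi [a] ↔ 0 < a :=
  ⟨fun h => (cons_mem_par.1 h.mem_par).2.1, fun ha => by constructor <;> simp [Par, diffs, ha]⟩

theorem isNandi_pair {a b : ℕ} : IsNandi [a, b] ↔ 0 < b ∧ b ≤ a ∧ a - b ≠ 1 := by
  refine ⟨fun h => ⟨isNandi_singleton.1 h.tail, (cons_mem_par.1 h.mem_par).2.2 b (by simp),
    h.cond1 0 (by simp)⟩, fun ⟨hb, hba, hne⟩ => ?_⟩
  constructor
  case mem_par => simp [Par, hb, hba, hb.trans_le hba]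
  case cond6 =>
    intro k hk
    have hlen := hk.length_le
    simp [diffs] at hlen
  case cond1 =>
    rintro (_ | i) hi
    exacts [hne, absurd hi (by simp)]
  all_goals simp

theorem isNandi_cons {a b c : ℕ} {r : List ℕ} :
    IsNandi (a :: b :: c :: r) ↔ IsNandi (b :: c :: r) ∧ b ≤ a ∧ a - b ≠ 1 ∧ 3 ≤ a - c ∧
      (a - c = 3 → a ≠ b) ∧ (a - c = 3 → ¬ 2 ∣ a → b ≠ c) ∧
      (a - c = 4 → ¬ 2 ∣ a → a ≠ b ∧ b ≠ c) ∧ (a - b = 3 → ¬ StartsFlagged (b :: c :: r)) := by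
  refine ⟨fun h => ⟨h.tail, (cons_mem_par.1 h.mem_par).2.2 b (by simp), h.cond1 0 (by simp),
    h.cond2 0 (by simp), h.cond3 0 (by simp), h.cond4 0 (by simp), h.cond5 0 (by simp), ?_⟩, ?_⟩
  · rintro hab ⟨k, hk⟩
    refine h.cond6 k (List.IsPrefix.isInfix ?_)
    rw [diffs_cons_cons, hab, List.append_assoc]
    exact List.cons_prefix_cons.2 ⟨rfl, hk⟩
  · rintro ⟨h, hba, h1, h2, h3, h4, h5, h6⟩
    refine ⟨cons_mem_par.2 ⟨h.mem_par, ?_, ?_⟩, ?_, ?_, ?_, ?_, ?_, fun k hk => ?_⟩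
    · omega
    · exact List.forall_mem_cons.2 ⟨hba, fun i hi =>
        ((List.pairwise_cons.1 h.mem_par.1).1 i hi).trans hba⟩
    · rintro (_ | i) hi
      exacts [h1, h.cond1 i (Nat.lt_of_succ_lt_succ hi)]
    · rintro (_ | i) hi
      exacts [h2, h.cond2 i (Nat.lt_of_succ_lt_succ hi)]
    · rintro (_ | i) hi
      exacts [h3, h.cond3 i (Nat.lt_of_succ_lt_succ hi)]
    · rintro (_ | i) hi
      exacts [h4, h.cond4 i (Nat.lt_of_succ_lt_succ hi)]
    · rintro (_ | i) hi
      exacts [h5, h.cond5 i (Nat.lt_of_succ_lt_succ hi)]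
    · rcases List.infix_cons_iff.1 hk with hk | hk
      · rw [List.append_assoc] at hk
        obtain ⟨hab, hk⟩ := List.cons_prefix_cons.1 hk
        exact h6 hab.symm ⟨k, hk⟩
      · exact h.cond6 k hk

open Classical in
/-- The state of the automaton after it has read an element of `𝒩`. -/
noncomputable def stateOf : List ℕ → State
  | [] => .init
  | [a] => ⟨a, .free⟩
  | a :: b :: r => ⟨a, if a = b then .double else if StartsFlagged (a :: b :: r) then .flagged
      else .ofGap (a - b) a⟩

open Classical in
theorem step_stateOf_pair {a b : ℕ} (hb : 0 < b) :
    step (stateOf [b]) a = if IsNandi [a, b] then some (stateOf [a, b]) else none := by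
  simp only [step, stateOf, Kind.next, isNandi_pair, not_startsFlagged_pair]
  grind

theorem StartsFlagged.sub_eq {a b : ℕ} {r : List ℕ} (h : StartsFlagged (a :: b :: r)) :
    a - b = 2 ∨ a - b = 3 := by
  cases r with
  | nil => exact absurd h (not_startsFlagged_pair a b)
  | cons c r => exact (startsFlagged_cons.1 h).imp And.left And.left

open Classical in
theorem step_stateOf_cons {a b c : ℕ} {r : List ℕ} (h : IsNandi (b :: c :: r)) :
    step (stateOf (b :: c :: r)) a =
      if IsNandi (a :: b :: c :: r) then some (stateOf (a :: b :: c :: r)) else none := by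
  have hcb : c ≤ b := (cons_mem_par.1 h.mem_par).2.2 c (by simp)
  have hbc : b - c ≠ 1 := h.cond1 0 (by simp)
  have hflagged := @StartsFlagged.sub_eq b c r
  simp only [step, stateOf, isNandi_cons, startsFlagged_cons (a := a), h, true_and]
  by_cases hdouble : b = c <;> by_cases hb : StartsFlagged (b :: c :: r) <;>
    simp only [hdouble, hb, if_true, if_false, Kind.next, Kind.ofGap] <;> grind

open Classical in
theorem run_init {l : List ℕ} (hl : ∀ i ∈ l, 0 < i) :
    run (some .init) l = if IsNandi l then some (stateOf l) else none := by
  induction l with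
  | nil => rw [if_pos isNandi_nil]; rfl
  | cons a l ih =>
    obtain ⟨ha, hl⟩ := List.forall_mem_cons.1 hl
    rw [run_cons, ih hl]
    by_cases h : IsNandi l
    · rw [if_pos h, Option.bind_some]
      match l with
      | [] => grind [step, stateOf, Kind.next, Kind.ofGap, State.init, isNandi_singleton]
      | [b] => exact step_stateOf_pair (hl b (by simp))
      | b :: c :: r => exact step_stateOf_cons h
    · rw [if_neg h, if_neg fun h' => h h'.tail, Option.bind_none]

theorem mem_accepted_init {l : List ℕ} : l ∈ accepted 0 (some .init) ↔ IsNandi l := by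
  refine ⟨fun ⟨hl, hrun⟩ => ?_, fun h => ⟨h.mem_par.2, ?_⟩⟩
  · by_contra h
    simp [run_init hl, h] at hrun
  · simp [run_init h.mem_par.2, h]

theorem N₁_eq_accepted : N₁ = accepted 1 (some .init) := by
  ext l
  rw [mem_accepted_succ, mem_accepted_init, N₁, Set.mem_ofPred_eq, List.count_eq_zero]

theorem concat_mem_accepted_iff_exists {k : ℕ} {s : State} {l : List ℕ} {a : ℕ} :
    l ++ [a] ∈ accepted k (some s) ↔
      k < a ∧ ∃ K, s.kind.next (a - s.last) a = some K ∧ l ∈ accepted k (some ⟨a, K⟩) := by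
  rw [concat_mem_accepted, step]
  cases s.kind.next (a - s.last) a <;> simp [accepted_none]

theorem add_two_le_of_mem_accepted_plain {k : ℕ} {p : ℤ} {l : List ℕ}
    (h : l ∈ accepted k (some ⟨p, .plain⟩)) : ∀ i ∈ l, p + 2 ≤ i := by
  cases l using List.reverseRecOn with
  | nil => simp
  | append_singleton l a =>
    obtain ⟨-, K, hK, -⟩ := concat_mem_accepted_iff_exists.1 h
    have hle := le_of_concat_mem_accepted h
    grind [Kind.next]

theorem mem_accepted_plain_iff {k p : ℕ} {l : List ℕ} :
    l ∈ accepted k (some ⟨p, .plain⟩) ↔ l ∈ accepted k (some ⟨p, .free⟩) ∧ p ∉ l := by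
  refine ⟨fun h => ⟨?_, fun hp => ?_⟩, fun ⟨h, hp⟩ => ?_⟩
  · cases l using List.reverseRecOn with
    | nil => exact nil_mem_accepted _ _
    | append_singleton l a =>
      rw [concat_mem_accepted_iff_exists] at h ⊢
      grind [Kind.next]
  · have := add_two_le_of_mem_accepted_plain h p hp
    omega
  · cases l using List.reverseRecOn with
    | nil => exact nil_mem_accepted _ _
    | append_singleton l a =>
      rw [concat_mem_accepted_iff_exists] at h ⊢
      grind [Kind.next]

theorem count_le_one_of_mem_accepted_plain {k : ℕ} {p : ℤ} {l : List ℕ} {i : ℕ}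
    (h : l ∈ accepted k (some ⟨p, .plain⟩)) (hi : i ≤ p + 3 ∨ i = p + 4 ∧ ¬ 2 ∣ i) :
    l.count i ≤ 1 := by
  induction l using List.reverseRecOn generalizing p with
  | nil => simp
  | append_singleton l a ih =>
    obtain ⟨-, K, hK, hl⟩ := concat_mem_accepted_iff_exists.1 h
    have hpa := add_two_le_of_mem_accepted_plain h a (by simp)
    rw [List.count_append, List.count_singleton]
    rcases lt_trichotomy i a with hia | rfl | hai
    · have hnot : i ∉ l := fun hil => hia.not_ge (le_of_concat_mem_accepted h i hil)
      grind
    · have hplain : K = .plain := by grind [Kind.next, Kind.ofGap]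
      subst hplain
      have hnot := (mem_accepted_plain_iff.1 hl).2
      grind
    · have hplain : K = .plain := by grind [Kind.next, Kind.ofGap]
      subst hplain
      have hcount := ih hl (by grind)
      grind

theorem concat_mem_accepted_init {l : List ℕ} {a : ℕ} :
    l ++ [a] ∈ accepted 0 (some .init) ↔ 0 < a ∧ l ∈ accepted 0 (some ⟨a, .free⟩) := by
  rw [concat_mem_accepted_iff_exists]
  grind [State.init, Kind.next, Kind.ofGap]

theorem concat_mem_accepted_neg_one_plain {l : List ℕ} {a : ℕ} :
    l ++ [a] ∈ accepted 0 (some ⟨-1, .plain⟩) ↔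
      (0 < a ∧ l ∈ accepted 0 (some ⟨a, .free⟩)) ∧ (a ≤ 3 → a ∉ l) := by
  rw [concat_mem_accepted_iff_exists]
  by_cases ha : a ≤ 3
  · have hplain := @mem_accepted_plain_iff 0 a l
    grind [Kind.next, Kind.ofGap]
  · grind [Kind.next, Kind.ofGap]

theorem N₂_eq_accepted : N₂ = accepted 0 (some ⟨-1, .plain⟩) := by
  ext l
  simp only [N₂, Set.mem_ofPred_eq, ← mem_accepted_init]
  cases l using List.reverseRecOn with
  | nil => simp [nil_mem_accepted]
  | append_singleton l a =>
    refine ⟨fun ⟨h, h₁, h₂, h₃⟩ => ?_, fun h => ⟨?_, ?_⟩⟩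
    · refine concat_mem_accepted_neg_one_plain.2 ⟨concat_mem_accepted_init.1 h, fun ha => ?_⟩
      have hpos := (concat_mem_accepted_init.1 h).1
      have hcount : (l ++ [a]).count a ≤ 1 := by interval_cases a <;> assumption
      simpa [List.count_eq_zero] using hcount
    · exact concat_mem_accepted_init.2 (concat_mem_accepted_neg_one_plain.1 h).1
    · refine ⟨?_, ?_, ?_⟩ <;> exact count_le_one_of_mem_accepted_plain h (by norm_num)

/-- The sequence `(2k, 2k - 2, …, 4, 2)`. -/
def evens (k : ℕ) : List ℕ := (List.range k).map (fun j => 2 * (k - j))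

theorem staircase_eq (k : ℕ) : staircase k = (2 * k + 3) :: evens k := rfl

theorem evens_zero : evens 0 = [] := rfl

theorem evens_succ (k : ℕ) : evens (k + 1) = (2 * k + 2) :: evens k := by
  simp [evens, List.range_succ_eq_map, Function.comp_def, mul_add_one]

theorem run_evens (k : ℕ) : run (some ⟨0, .flagged⟩) (evens k) = some ⟨2 * k, .flagged⟩ := by
  induction k with
  | zero => rfl
  | succ k ih =>
    rw [evens_succ, run_cons, ih]
    simp [step, Kind.next, mul_add_one]

theorem accepted_flagged_subset_plain (k : ℕ) (p : ℤ) :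
    accepted k (some ⟨p, .flagged⟩) ⊆ accepted k (some ⟨p, .plain⟩) := by
  intro l h
  induction l using List.reverseRecOn generalizing p with
  | nil => exact nil_mem_accepted _ _
  | append_singleton l a ih =>
    rw [concat_mem_accepted_iff_exists] at h ⊢
    grind [Kind.next, Kind.ofGap]

theorem not_staircase_suffix {l : List ℕ} (h : l ∈ accepted 0 (some ⟨0, .flagged⟩)) (k : ℕ) :
    ¬ staircase k <:+ l := by
  rintro ⟨u, rfl⟩
  have hreject : step ⟨2 * k, .flagged⟩ (2 * k + 3) = none := by simp [step, Kind.next]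
  have hrun := h.2
  simp [run_append, staircase_eq, run_cons, run_evens, hreject, run_none] at hrun

theorem mem_accepted_flagged {j : ℕ} {l : List ℕ}
    (h : l ∈ accepted 0 (some ⟨2 * j, .plain⟩)) (hs : ∀ k, ¬ staircase k <:+ l ++ evens j) :
    l ∈ accepted 0 (some ⟨2 * j, .flagged⟩) := by
  induction l using List.reverseRecOn generalizing j with
  | nil => exact nil_mem_accepted _ _
  | append_singleton l a ih =>
    rw [concat_mem_accepted_iff_exists] at h ⊢
    have hodd : a ≠ 2 * j + 3 := by
      rintro rfl
      exact hs j ⟨l, by simp [staircase_eq]⟩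
    have heven : a = 2 * j + 2 → l ∈ accepted 0 (some ⟨a, .plain⟩) →
        l ∈ accepted 0 (some ⟨a, .flagged⟩) := by
      rintro rfl hl
      have hcast : ((2 * j + 2 : ℕ) : ℤ) = 2 * (j + 1 : ℕ) := by push_cast; ring
      rw [hcast] at hl ⊢
      exact ih hl (by simpa [evens_succ] using hs)
    grind [Kind.next, Kind.ofGap]

theorem ne_add_three_of_mem_accepted_flagged {k : ℕ} {p : ℤ} {l : List ℕ}
    (h : l ∈ accepted k (some ⟨p, .flagged⟩)) : ∀ i ∈ l, (i : ℤ) ≠ p + 3 := by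
  cases l using List.reverseRecOn with
  | nil => simp
  | append_singleton l a =>
    obtain ⟨-, K, hK, hl⟩ := concat_mem_accepted_iff_exists.1 h
    have hle := le_of_concat_mem_accepted h
    have hplain : K = .flagged → ∀ i ∈ l, (a : ℤ) + 2 ≤ i := by
      rintro rfl
      exact add_two_le_of_mem_accepted_plain (accepted_flagged_subset_plain k a hl)
    grind [Kind.next, Kind.ofGap]

theorem mem_accepted_zero_plain {l : List ℕ} :
    l ∈ accepted 0 (some ⟨0, .plain⟩) ↔ l ∈ N₂ ∧ 1 ∉ l := by
  have hstep (a : ℕ) (ha : 1 < a) : step ⟨-1, .plain⟩ a = step ⟨0, .plain⟩ a := by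
    grind [step, Kind.next, Kind.ofGap]
  rw [N₂_eq_accepted, ← mem_accepted_succ, accepted_congr hstep, mem_accepted_succ]
  exact ⟨fun h => ⟨h, fun h1 => by simpa using add_two_le_of_mem_accepted_plain h 1 h1⟩, And.left⟩

theorem not_staircase_infix {l : List ℕ} (h : l ∈ accepted 0 (some ⟨0, .flagged⟩)) {k : ℕ}
    (hk : 1 ≤ k) : ¬ staircase k <:+: l := by
  have hplain := accepted_flagged_subset_plain 0 0 h
  obtain ⟨⟨hl, -, hcount, -⟩, hone⟩ := mem_accepted_zero_plain.1 hplain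
  rintro ⟨u, v, rfl⟩
  have htwo : 2 ∈ staircase k := by
    simp only [staircase_eq, evens, List.mem_cons, List.mem_map, List.mem_range]
    exact Or.inr ⟨k - 1, by omega, by omega⟩
  cases v with
  | nil => exact not_staircase_suffix h k ⟨u, by simp⟩
  | cons b v =>
    have hb : b ≤ 2 := (List.pairwise_append.1 hl.mem_par.1).2.2 2 (by simp [htwo]) b (by simp)
    have hpos : 0 < b := hl.mem_par.2 b (by simp)
    have hb_ne : b ≠ 1 := by
      rintro rfl
      exact hone (by simp)
    obtain rfl : b = 2 := by omega
    have hstaircase : 0 < (staircase k).count 2 := List.count_pos_iff.2 htwo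
    simp only [List.count_append, List.count_cons_self] at hcount
    omega

theorem N₃_eq_accepted : N₃ = accepted 0 (some ⟨0, .flagged⟩) := by
  ext l
  refine ⟨fun ⟨hl, h₁, h₃, h₂, hs⟩ => ?_, fun h => ?_⟩
  · have hplain : l ∈ accepted 0 (some ⟨0, .plain⟩) :=
      mem_accepted_zero_plain.2 ⟨⟨hl, h₁.trans_le zero_le_one, h₂, h₃.trans_le zero_le_one⟩,
        List.count_eq_zero.1 h₁⟩
    refine mem_accepted_flagged (j := 0) hplain fun k hk => ?_
    rw [evens_zero, List.append_nil] at hk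
    cases k with
    | zero => exact List.count_eq_zero.1 h₃ (hk.mem (by simp [staircase]))
    | succ k => exact hs (k + 1) k.succ_pos hk.isInfix
  · obtain ⟨⟨hl, -, h₂, -⟩, h₁⟩ := mem_accepted_zero_plain.1 (accepted_flagged_subset_plain 0 0 h)
    have h₃ : 3 ∉ l := fun h₃ => ne_add_three_of_mem_accepted_flagged h 3 h₃ (by norm_num)
    exact ⟨hl, List.count_eq_zero.2 h₁, List.count_eq_zero.2 h₃, h₂,
      fun k => not_staircase_infix h⟩

/-! ### Generating functions -/

theorem genFun_empty : genFun ∅ = 0 := by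
  ext m n
  simp [genFun, level]

theorem genFun_union {A B : Set (List ℕ)} (h : Disjoint A B) :
    genFun (A ∪ B) = genFun A + genFun B := by
  ext m n
  have hlevel : level (A ∪ B) m n = level A m n ∪ level B m n := Set.union_inter_distrib_right ..
  have hdisj : Disjoint (level A m n) (level B m n) := h.mono (fun _ hl => hl.1) (fun _ hl => hl.1)
  simp [genFun, hlevel, Set.ncard_union_eq hdisj (level_finite A m n) (level_finite B m n)]

theorem coeff_genFun (C : Set (List ℕ)) (m n : ℕ) :
    PowerSeries.coeff n (PowerSeries.coeff m (genFun C)) = (level C m n).ncard := by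
  simp [genFun]

theorem coeff_genFun_image {g : List ℕ → List ℕ} (hg : g.Injective) (C : Set (List ℕ))
    (m n : ℕ) :
    PowerSeries.coeff n (PowerSeries.coeff m (genFun (g '' C))) =
      {l ∈ C | (g l).length = m ∧ (g l).sum = n}.ncard := by
  have himage : level (g '' C) m n = g '' {l ∈ C | (g l).length = m ∧ (g l).sum = n} :=
    (Set.image_inter_preimage g C {l | l.length = m ∧ l.sum = n}).symm
  rw [coeff_genFun, himage, Set.ncard_image_of_injective _ hg]

theorem genFun_image_concat (a : ℕ) (C : Set (List ℕ)) :
    genFun ((· ++ [a]) '' C) = x * q ^ a * genFun C := by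
  ext m n
  rw [coeff_genFun_image (List.append_left_injective [a]), x, q, ← map_pow, mul_assoc]
  cases m with
  | zero => simp
  | succ m =>
    rw [PowerSeries.coeff_succ_X_mul, PowerSeries.coeff_C_mul, PowerSeries.coeff_X_pow_mul']
    simp only [List.length_append, List.length_singleton, List.sum_append, List.sum_singleton,
      Nat.add_right_cancel_iff]
    split_ifs with han
    · rw [coeff_genFun, level]
      congr! 6
      omega
    · have hempty : {l ∈ C | l.length = m ∧ l.sum + a = n} = ∅ := by grind
      rw [hempty, Set.ncard_empty, Nat.cast_zero]

theorem sum_map_add_const (k : ℕ) (l : List ℕ) : (l.map (· + k)).sum = l.sum + k * l.length := by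
  simp [List.sum_map_add, mul_comm]

theorem genFun_image_map_add (k : ℕ) (C : Set (List ℕ)) :
    genFun (List.map (· + k) '' C) = qShift k (genFun C) := by
  ext m n
  rw [coeff_genFun_image (List.map_injective_iff.2 (add_left_injective k)), qShift,
    PowerSeries.coeff_rescale, ← pow_mul, PowerSeries.coeff_X_pow_mul']
  simp only [List.length_map, sum_map_add_const]
  split_ifs with hkm
  · rw [coeff_genFun, level]
    congr 3 with l
    grind
  · have hempty : {l ∈ C | l.length = m ∧ l.sum + k * l.length = n} = ∅ := by grind
    rw [hempty, Set.ncard_empty, Nat.cast_zero]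

/-- The generating function of the lists of integers greater than `k` that are accepted from a
given state. -/
noncomputable def gf (k : ℕ) (s : Option State) : PowerSeries (PowerSeries ℤ) :=
  genFun (accepted k s)

theorem gf_none (k : ℕ) : gf k none = 0 := by rw [gf, accepted_none, genFun_empty]

theorem gf_congr {k : ℕ} {s t : State} (h : ∀ a, k < a → step s a = step t a) :
    gf k (some s) = gf k (some t) := by rw [gf, gf, accepted_congr h]

theorem gf_eq_add (k : ℕ) (s : State) :
    gf k (some s) = gf (k + 1) (some s) + x * q ^ (k + 1) * gf k (step s (k + 1)) := by
  rw [gf, accepted_eq_union, genFun_union (disjoint_accepted_succ ..), genFun_image_concat, gf, gf]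

/-- The substitution `f(x, q) ↦ f(x q^2, q)`, as a ring homomorphism. -/
noncomputable def qShiftTwo : PowerSeries (PowerSeries ℤ) →+* PowerSeries (PowerSeries ℤ) :=
  PowerSeries.rescale (PowerSeries.X ^ 2)

theorem qShiftTwo_x : qShiftTwo x = x * q ^ 2 := by
  simp [qShiftTwo, x, q, PowerSeries.rescale_X, mul_comm]

theorem qShiftTwo_q : qShiftTwo q = q := by
  ext m : 1
  cases m <;> simp [qShiftTwo, q, PowerSeries.coeff_C]

theorem qShift_two_mul (i : ℕ) (f : PowerSeries (PowerSeries ℤ)) :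
    qShift (2 * i) f = qShiftTwo^[i] f := by
  induction i with
  | zero => simp [qShift]
  | succ i ih =>
    rw [Function.iterate_succ_apply', ← ih, qShift, qShift, qShiftTwo, PowerSeries.rescale_rescale,
      ← pow_add, mul_add_one]

theorem gf_add_two (k : ℕ) (s : Option State) :
    gf (k + 2) s = qShiftTwo (gf k (s.map State.shift)) := by
  rw [gf, accepted_add_two, genFun_image_map_add]
  rfl

theorem gf_eq_succ {k : ℕ} {s : State} (h : step s (k + 1) = none) :
    gf k (some s) = gf (k + 1) (some s) := by
  rw [gf_eq_add, h, gf_none, mul_zero, add_zero]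

theorem gf_one_eq_qShiftTwo {s : State} (h₂ : step s 2 = none) :
    gf 1 (some s) = qShiftTwo (gf 0 (some s.shift)) := by
  rw [gf_eq_succ h₂, gf_add_two, Option.map_some]

theorem gf_zero_eq_qShiftTwo {s : State} (h₁ : step s 1 = none) (h₂ : step s 2 = none) :
    gf 0 (some s) = qShiftTwo (gf 0 (some s.shift)) := by
  rw [gf_eq_succ h₁, gf_one_eq_qShiftTwo h₂]

theorem gf_zero_init :
    gf 0 (some .init) = gf 1 (some .init) + x * q * qShiftTwo (gf 0 (some ⟨-1, .plain⟩)) +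
      x ^ 2 * q ^ 2 * qShiftTwo (gf 0 (some ⟨0, .flagged⟩)) := by
  have hread : gf 0 (some .init) = gf 1 (some .init) + x * q ^ 1 * gf 0 (some ⟨1, .free⟩) :=
    gf_eq_add 0 .init
  have hrepeat : gf 0 (some ⟨1, .free⟩) =
      gf 1 (some ⟨1, .free⟩) + x * q ^ 1 * gf 0 (some ⟨1, .double⟩) :=
    gf_eq_add 0 ⟨1, .free⟩
  have hfree : gf 1 (some ⟨1, .free⟩) = qShiftTwo (gf 0 (some ⟨-1, .plain⟩)) := by
    rw [gf_one_eq_qShiftTwo rfl, State.shift, gf_congr]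
    grind [step, Kind.next]
  have hdouble : gf 0 (some ⟨1, .double⟩) = qShiftTwo (gf 0 (some ⟨0, .flagged⟩)) := by
    rw [gf_zero_eq_qShiftTwo rfl rfl, State.shift, gf_congr]
    grind [step, Kind.next, Kind.ofGap]
  linear_combination hread + x * q * hrepeat + x * q * hfree + x ^ 2 * q ^ 2 * hdouble

theorem gf_one_init :
    gf 1 (some .init) = qShiftTwo (gf 0 (some .init)) +
      x * q ^ 2 * qShiftTwo (gf 1 (some ⟨0, .plain⟩)) +
      x ^ 2 * q ^ 4 * qShiftTwo (qShiftTwo (gf 1 (some .init))) := by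
  have hread : gf 1 (some .init) = gf 2 (some .init) + x * q ^ 2 * gf 1 (some ⟨2, .free⟩) :=
    gf_eq_add 1 .init
  have hinit : gf 2 (some .init) = qShiftTwo (gf 0 (some .init)) := by
    rw [gf_add_two, Option.map_some, State.shift, gf_congr]
    grind [step, Kind.next, Kind.ofGap, State.init]
  have hrepeat : gf 1 (some ⟨2, .free⟩) =
      gf 2 (some ⟨2, .free⟩) + x * q ^ 2 * gf 1 (some ⟨2, .double⟩) :=
    gf_eq_add 1 ⟨2, .free⟩
  have hfree : gf 2 (some ⟨2, .free⟩) = qShiftTwo (gf 1 (some ⟨0, .plain⟩)) := by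
    rw [gf_add_two, Option.map_some, State.shift, gf_eq_succ rfl, gf_congr]
    grind [step, Kind.next]
  have hdouble : gf 1 (some ⟨2, .double⟩) = qShiftTwo (qShiftTwo (gf 1 (some .init))) := by
    rw [gf_one_eq_qShiftTwo rfl, State.shift, gf_zero_eq_qShiftTwo rfl rfl, State.shift,
      gf_eq_succ rfl, gf_congr]
    grind [step, Kind.next, Kind.ofGap, State.init]
  linear_combination hread + hinit + x * q ^ 2 * hrepeat + x * q ^ 2 * hfree +
    x ^ 2 * q ^ 4 * hdouble

theorem gf_zero_one_plain :
    gf 0 (some ⟨1, .plain⟩) = qShiftTwo (gf 0 (some ⟨-1, .plain⟩)) :=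
  gf_zero_eq_qShiftTwo rfl rfl

theorem gf_zero_neg_one_plain :
    gf 0 (some ⟨-1, .plain⟩) = gf 1 (some ⟨0, .plain⟩) +
      x * q * qShiftTwo (gf 0 (some ⟨-1, .plain⟩)) := by
  have hread : gf 0 (some ⟨-1, .plain⟩) =
      gf 1 (some ⟨-1, .plain⟩) + x * q ^ 1 * gf 0 (some ⟨1, .plain⟩) :=
    gf_eq_add 0 ⟨-1, .plain⟩
  have hplain : gf 1 (some ⟨-1, .plain⟩) = gf 1 (some ⟨0, .plain⟩) := by
    rw [gf_congr]
    grind [step, Kind.next, Kind.ofGap]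
  linear_combination hread + hplain + x * q * gf_zero_one_plain

theorem gf_one_zero_plain :
    gf 1 (some ⟨0, .plain⟩) = qShiftTwo (gf 1 (some .init)) +
      x * q ^ 3 * qShiftTwo (qShiftTwo (gf 0 (some ⟨-1, .plain⟩))) +
      x * q ^ 2 * qShiftTwo (gf 1 (some ⟨0, .plain⟩)) := by
  have hread : gf 1 (some ⟨0, .plain⟩) =
      gf 2 (some ⟨0, .plain⟩) + x * q ^ 2 * gf 1 (some ⟨2, .plain⟩) :=
    gf_eq_add 1 ⟨0, .plain⟩
  have hinit : gf 1 (some ⟨-2, .plain⟩) = gf 1 (some .init) := by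
    rw [gf_congr]
    grind [step, Kind.next, Kind.ofGap, State.init]
  have hskip : gf 2 (some ⟨0, .plain⟩) = qShiftTwo (gf 1 (some .init)) +
      x * q ^ 3 * qShiftTwo (qShiftTwo (gf 0 (some ⟨-1, .plain⟩))) :=
    calc gf 2 (some ⟨0, .plain⟩)
      _ = qShiftTwo (gf 0 (some ⟨-2, .plain⟩)) := gf_add_two 0 (some ⟨0, .plain⟩)
      _ = qShiftTwo (gf 1 (some ⟨-2, .plain⟩) + x * q ^ 1 * gf 0 (some ⟨1, .plain⟩)) :=
        congrArg qShiftTwo (gf_eq_add 0 ⟨-2, .plain⟩)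
      _ = _ := by
        rw [hinit, gf_zero_one_plain, map_add, map_mul, map_mul, map_pow, qShiftTwo_x, qShiftTwo_q]
        ring
  have htwo : gf 1 (some ⟨2, .plain⟩) = qShiftTwo (gf 1 (some ⟨0, .plain⟩)) := by
    rw [gf_one_eq_qShiftTwo rfl, State.shift, gf_eq_succ rfl, sub_self]
  linear_combination hread + hskip + x * q ^ 2 * htwo

theorem gf_zero_flagged :
    gf 0 (some ⟨0, .flagged⟩) = qShiftTwo (gf 1 (some .init)) +
      x * q ^ 2 * qShiftTwo (gf 0 (some ⟨0, .flagged⟩)) := by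
  have hskip : gf 0 (some ⟨0, .flagged⟩) = gf 1 (some ⟨0, .flagged⟩) := gf_eq_succ rfl
  have hread : gf 1 (some ⟨0, .flagged⟩) =
      gf 2 (some ⟨0, .flagged⟩) + x * q ^ 2 * gf 1 (some ⟨2, .flagged⟩) :=
    gf_eq_add 1 ⟨0, .flagged⟩
  have hinit : gf 2 (some ⟨0, .flagged⟩) = qShiftTwo (gf 1 (some .init)) := by
    rw [gf_add_two, Option.map_some, State.shift, gf_eq_succ rfl, gf_congr]
    grind [step, Kind.next, Kind.ofGap, State.init]
  have hflagged : gf 1 (some ⟨2, .flagged⟩) = qShiftTwo (gf 0 (some ⟨0, .flagged⟩)) := by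
    rw [gf_one_eq_qShiftTwo rfl, State.shift, sub_self]
  linear_combination hskip + hread + hinit + x * q ^ 2 * hflagged

/-! ### Elimination -/

theorem sum_mul_iterate {R : Type*} [Semiring R] (σ : R → R) (c : Fin 6 → R) (f : R) :
    ∑ i : Fin 6, c i * σ^[i] f = c 0 * f + c 1 * σ f + c 2 * σ (σ f) + c 3 * σ (σ (σ f)) +
      c 4 * σ (σ (σ (σ f))) + c 5 * σ (σ (σ (σ (σ f)))) :=
  Fin.sum_univ_six _

/-- The `q`-difference system that peeling off the parts `1` and `2` yields, with `σ` for the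
substitution `x ↦ x q ^ 2`. The unknown `A` stands for the series of `𝒩`, `T`, `B` and `U` for those
of `𝒩₁`, `𝒩₂` and `𝒩₃`, and `P` for that of `𝒩₁ ∩ 𝒩₂`. -/
structure IsNandiSystem {R : Type*} [CommRing R] (σ : R →+* R) (x q A B P T U : R) : Prop where
  map_x : σ x = x * q ^ 2
  map_q : σ q = q
  eq_A : A = T + x * q * σ B + x ^ 2 * q ^ 2 * σ U
  eq_B : B = P + x * q * σ B
  eq_P : P = σ T + x * q ^ 3 * σ (σ B) + x * q ^ 2 * σ P
  eq_T : T = σ A + x * q ^ 2 * σ P + x ^ 2 * q ^ 4 * σ (σ T)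
  eq_U : U = σ T + x * q ^ 2 * σ U

namespace IsNandiSystem

variable {R : Type*} [CommRing R] {σ : R →+* R} {x q A B P T U : R}

theorem σ_T_eq (h : IsNandiSystem σ x q A B P T U) :
    σ T = B - x * (q + q ^ 2) * σ B - x * q ^ 3 * (1 - x * q ^ 2) * σ (σ B) := by
  have hσ := congrArg σ h.eq_B
  simp only [map_add, map_mul, h.map_x, h.map_q] at hσ
  linear_combination -h.eq_P - h.eq_B + x * q ^ 2 * hσ

theorem T_eq_P_add (h : IsNandiSystem σ x q A B P T U) :
    T = P + x ^ 2 * q ^ 6 * σ (σ U) + x ^ 2 * q ^ 4 * σ (σ T) := by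
  have hσA := congrArg σ h.eq_A
  simp only [map_add, map_mul, map_pow, h.map_x, h.map_q] at hσA
  linear_combination h.eq_T - h.eq_P + hσA

theorem T_sub_eq (h : IsNandiSystem σ x q A B P T U) :
    T - (1 + x * q ^ 2) * σ T - x ^ 2 * q ^ 4 * σ (σ T) -
      x ^ 2 * q ^ 6 * (1 - x * q ^ 4) * σ (σ (σ T)) = x * q ^ 3 * σ (σ B) := by
  have hσT := congrArg σ h.T_eq_P_add
  have hσU := congrArg σ h.eq_U
  simp only [map_add, map_mul, map_pow, h.map_x, h.map_q] at hσT hσU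
  have hσσU := congrArg σ hσU
  simp only [map_add, map_mul, map_pow, h.map_x, h.map_q] at hσσU
  linear_combination h.T_eq_P_add - x * q ^ 2 * hσT + h.eq_P + x ^ 2 * q ^ 6 * hσσU

theorem P_sub_eq (h : IsNandiSystem σ x q A B P T U) :
    P - x * (q ^ 2 + q ^ 3) * σ P - x * q ^ 3 * (1 - x * q ^ 4) * σ (σ P) =
      σ T - x * q ^ 3 * σ (σ T) := by
  have hσP := congrArg σ h.eq_P
  have hσB := congrArg σ h.eq_B
  simp only [map_add, map_mul, map_pow, h.map_x, h.map_q] at hσP hσB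
  have hσσB := congrArg σ hσB
  simp only [map_add, map_mul, map_pow, h.map_x, h.map_q] at hσσB
  linear_combination h.eq_P - x * q ^ 3 * hσP + x * q ^ 3 * hσσB

theorem σ_P_eq (h : IsNandiSystem σ x q A B P T U) :
    σ P = U - x * q ^ 2 * σ U - x ^ 2 * q ^ 8 * σ (σ U) -
      x ^ 2 * q ^ 10 * (1 - x * q ^ 4) * σ (σ (σ U)) := by
  have hσT := congrArg σ h.T_eq_P_add
  have hσσU := congrArg σ (congrArg σ h.eq_U)
  simp only [map_add, map_mul, map_pow, h.map_x, h.map_q] at hσT hσσU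
  linear_combination -hσT - h.eq_U + x ^ 2 * q ^ 8 * hσσU

theorem sum_p₁_T (h : IsNandiSystem σ x q A B P T U) : 0 = ∑ i : Fin 6, p₁ x q i * σ^[i] T := by
  have hσσσT := congrArg σ (congrArg σ h.σ_T_eq)
  have hσ := congrArg σ h.T_sub_eq
  simp only [map_add, map_sub, map_mul, map_pow, map_one, h.map_x, h.map_q] at hσσσT hσ
  have hσσ := congrArg σ hσ
  simp only [map_add, map_sub, map_mul, map_pow, map_one, h.map_x, h.map_q] at hσσ
  simp only [sum_mul_iterate, p₁, Matrix.cons_val]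
  linear_combination -h.T_sub_eq + x * q ^ 3 * hσσσT + x * q ^ 3 * (1 + q) * hσ +
    x * q ^ 3 * (1 - x * q ^ 6) * hσσ

theorem sum_p₂_B (h : IsNandiSystem σ x q A B P T U) : 0 = ∑ i : Fin 6, p₂ x q i * σ^[i] B := by
  have hσσT := congrArg σ h.σ_T_eq
  have hσ := congrArg σ h.T_sub_eq
  simp only [map_add, map_sub, map_mul, map_pow, map_one, h.map_x, h.map_q] at hσσT hσ
  have hσσσT := congrArg σ hσσT
  simp only [map_add, map_sub, map_mul, map_pow, map_one, h.map_x, h.map_q] at hσσσT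
  have hσσσσT := congrArg σ hσσσT
  simp only [map_add, map_sub, map_mul, map_pow, map_one, h.map_x, h.map_q] at hσσσσT
  simp only [sum_mul_iterate, p₂, Matrix.cons_val]
  linear_combination -hσ + h.σ_T_eq - (1 + x * q ^ 4) * hσσT - x ^ 2 * q ^ 8 * hσσσT -
    x ^ 2 * q ^ 10 * (1 - x * q ^ 6) * hσσσσT

theorem sum_p₃_U (h : IsNandiSystem σ x q A B P T U) : 0 = ∑ i : Fin 6, p₃ x q i * σ^[i] U := by
  have hσU := congrArg σ h.eq_U
  have hσσP := congrArg σ h.σ_P_eq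
  have hσ := congrArg σ h.P_sub_eq
  simp only [map_add, map_sub, map_mul, map_pow, map_one, h.map_x, h.map_q] at hσU hσσP hσ
  have hσσU := congrArg σ hσU
  have hσσσP := congrArg σ hσσP
  simp only [map_add, map_sub, map_mul, map_pow, map_one, h.map_x, h.map_q] at hσσU hσσσP
  simp only [sum_mul_iterate, p₃, Matrix.cons_val]
  linear_combination -hσ + h.σ_P_eq - x * (q ^ 4 + q ^ 5) * hσσP -
    x * q ^ 5 * (1 - x * q ^ 6) * hσσσP + hσU - x * q ^ 5 * hσσU

end IsNandiSystem

theorem isNandiSystem_gf :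
    IsNandiSystem qShiftTwo x q (gf 0 (some .init)) (gf 0 (some ⟨-1, .plain⟩))
      (gf 1 (some ⟨0, .plain⟩)) (gf 1 (some .init)) (gf 0 (some ⟨0, .flagged⟩)) where
  map_x := qShiftTwo_x
  map_q := qShiftTwo_q
  eq_A := gf_zero_init
  eq_B := gf_zero_neg_one_plain
  eq_P := gf_one_zero_plain
  eq_T := gf_one_init
  eq_U := gf_zero_flagged

end Nandi

theorem proposition4p1 :
    (0 = ∑ i : Fin 6, Nandi.p₁ Nandi.x Nandi.q i *
      Nandi.qShift (2 * (i : ℕ)) (Nandi.genFun Nandi.N₁)) ∧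
    (0 = ∑ i : Fin 6, Nandi.p₂ Nandi.x Nandi.q i *
      Nandi.qShift (2 * (i : ℕ)) (Nandi.genFun Nandi.N₂)) ∧
    (0 = ∑ i : Fin 6, Nandi.p₃ Nandi.x Nandi.q i *
      Nandi.qShift (2 * (i : ℕ)) (Nandi.genFun Nandi.N₃)) := by
  have h := Nandi.isNandiSystem_gf
  simp only [Nandi.qShift_two_mul, Nandi.N₁_eq_accepted, Nandi.N₂_eq_accepted, Nandi.N₃_eq_accepted]
  exact ⟨h.sum_p₁_T, h.sum_p₂_B, h.sum_p₃_U⟩
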